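/- **Setting.** Let $n\ge 1$ and let $(M,g)$ be a compact connected smooth Riemannian manifold of dimension $n+1$ (a boundary is allowed), with Riemannian distance $d$. Let $\mathcal F$ be a smooth codimension one foliation of $M$, given by its tangent field: a field of hyperplanes which is locally of the form $\ker du$ for a smooth submersion $u$ into $\mathbb R$. The leaf through $x$ consists of the points which can be joined to $x$ by a piecewise $C^1$ curve tangent to the field. **Hausdorff leaf space.** For leaves $L,L'$ put $\operatorname{dist}(L,L')=\inf\{d(x,y):x\in L,\ y\in L'\}$ and $$\rho(L,L')=\inf\sum_{i=1}^{k-1}\operatorname{dist}(L_i,L_{i+1}),$$ the infimum being over all finite sequences of leaves with $L_1=L$ and $L_k=L'$. The Hausdorff leaf space $\mathrm{HLS}(\mathcal F)$ is the metric space obtained from the set of leaves with the pseudo-metric $\rho$ by identifying $L$ and $L'$ whenever $\rho(L,L')=0$; let $\pi:M\to \mathrm{HLS}(\mathcal F)$ be the natural projection. **Turbulization.** Let $\gamma$ be a smooth closed curve in $M$, parametrized by $[0,1]$ (extended $1$-periodically) and nowhere tangent to $\mathcal F$, and let $N(\gamma)\cong D^n\times S^1$ be a foliated tubular neighbourhood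 of $\gamma$, where $D^n$ is the unit disc and $S^1=\mathbb R/\mathbb Z$: an open subset of $M$ with smooth coordinates $(x,t)$ in which $\gamma(t)=(0,t)$ and $\mathcal F$ is the foliation by the discs $D^n\times\{t\}$. Write $r=\|x\|$. Let $\lambda:[0,1]\to[-\pi/2,\pi/2]$ be smooth, strictly increasing on $[0,3/4]$, with $\lambda(0)=-\pi/2$, $\lambda(2/3)=0$, $\lambda(r)=\pi/2$ for $r\ge 3/4$, and with all derivatives of order at least one vanishing at $0$. The turbulized foliation $\mathcal F_\gamma$ is the one which is tangent to the kernel of $$\omega=\cos\lambda(r)\,dr+\sin\lambda(r)\,dt$$ in $N(\gamma)$ and agrees with $\mathcal F$ outside $N(\gamma)$. Let $\pi_\gamma:M\to \mathrm{HLS}(\mathcal F_\gamma)$ be the natural projection. **Collapsed space.** Let $X$ be the set obtained from $\mathrm{HLS}(\mathcal F)$ by identifying all points of $\pi(\gamma([0,1]))$ to one point, let $p:\mathrm{HLS}(\mathcal F)\to X$ be the projection, and let $d_X$ be the quotient (pseudo-)metric: $d_X(a,b)$ is the infimum of $\sum_i \operatorname{dist}(a_i,a_{i+1})$ over finite sequences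 of points of $X$ from $a$ to $b$, where $\operatorname{dist}$ of two points of $X$ is the infimum distance in $\mathrm{HLS}(\mathcal F)$ between their preimages. **Theorem (Turbulization).** The Hausdorff leaf space $\mathrm{HLS}(\mathcal F_\gamma)$ is isometric to $(X,d_X)$. More precisely, there is a bijective isometry $f:X\to \mathrm{HLS}(\mathcal F_\gamma)$ with $f(p(\pi(x)))=\pi_\gamma(x)$ for all $x\in M$. -/

import Mathlib

open Set Manifold
open scoped ContDiff ENNReal Topology Bundle

noncomputable section

/-! ### Quotient pseudo-metrics -/

section Quotients

variable {X : Type*} [PseudoMetricSpace X]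

/-- The quotient of a pseudo-metric space by an equivalence relation, to be endowed with the
quotient pseudo-metric (a copy of `Quotient s`, which carries no metric by itself). -/
def MetricQuotient (s : Setoid X) : Type _ := Quotient s

namespace MetricQuotient

/-- The canonical projection. -/
def mk (s : Setoid X) (x : X) : MetricQuotient s := Quotient.mk s x

/-- The distance `inf {d(x, y) : x ∈ a, y ∈ b}` between two equivalence classes. -/
def classDist (s : Setoid X) (a b : MetricQuotient s) : ℝ≥0∞ :=
  ⨅ (x : X) (y : X) (_ : mk s x = a) (_ : mk s y = b), edist x y

/-- The infimum of the sums `∑ dist(c i, c (i + 1))` over all finite sequences of equivalence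
classes which begin at `a` and end at `b`. -/
def chainDist (s : Setoid X) (a b : MetricQuotient s) : ℝ≥0∞ :=
  ⨅ (k : ℕ) (c : ℕ → MetricQuotient s) (_ : c 0 = a) (_ : c k = b),
    ∑ i ∈ Finset.range k, classDist s (c i) (c (i + 1))

lemma classDist_comm (s : Setoid X) (a b : MetricQuotient s) :
    classDist s a b = classDist s b a := by
  apply le_antisymm
  · refine le_iInf fun x => le_iInf fun y => le_iInf fun hx => le_iInf fun hy => ?_
    rw [edist_comm]
    exact iInf_le_of_le y (iInf_le_of_le x (iInf_le_of_le hy (iInf_le_of_le hx le_rfl)))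
  · refine le_iInf fun x => le_iInf fun y => le_iInf fun hx => le_iInf fun hy => ?_
    rw [edist_comm]
    exact iInf_le_of_le y (iInf_le_of_le x (iInf_le_of_le hy (iInf_le_of_le hx le_rfl)))

lemma chainDist_le (s : Setoid X) {a b : MetricQuotient s} (k : ℕ) (c : ℕ → MetricQuotient s)
    (h0 : c 0 = a) (hk : c k = b) :
    chainDist s a b ≤ ∑ i ∈ Finset.range k, classDist s (c i) (c (i + 1)) :=
  iInf_le_of_le k (iInf_le_of_le c (iInf_le_of_le h0 (iInf_le_of_le hk le_rfl)))

lemma chainDist_self (s : Setoid X) (a : MetricQuotient s) : chainDist s a a = 0 :=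
  le_antisymm (by simpa using chainDist_le s 0 (fun _ => a) rfl rfl) bot_le

lemma chainDist_comm_le (s : Setoid X) (a b : MetricQuotient s) :
    chainDist s b a ≤ chainDist s a b := by
  refine le_iInf fun k => le_iInf fun c => le_iInf fun h0 => le_iInf fun hk => ?_
  refine (chainDist_le s k (fun i => c (k - i)) (by simpa using hk) (by simpa using h0)).trans
    (le_of_eq ?_)
  rw [← Finset.sum_range_reflect]
  refine Finset.sum_congr rfl fun i hi => ?_
  have hi' : i < k := Finset.mem_range.1 hi
  rw [classDist_comm]
  congr 2 <;> omega

lemma chainDist_triangle (s : Setoid X) (a b d : MetricQuotient s) :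
    chainDist s a d ≤ chainDist s a b + chainDist s b d := by
  refine ENNReal.le_of_forall_pos_le_add fun ε hε hfin => ?_
  have hε' : (0 : ℝ≥0∞) < (ε / 2 : NNReal) := by
    have : 0 < ε / 2 := half_pos hε
    exact_mod_cast this
  have h1 : chainDist s a b ≠ ⊤ := (lt_of_le_of_lt le_self_add hfin).ne
  have h2 : chainDist s b d ≠ ⊤ := (lt_of_le_of_lt le_add_self hfin).ne
  have l1 := ENNReal.lt_add_right h1 hε'.ne'
  have l2 := ENNReal.lt_add_right h2 hε'.ne'
  rw [chainDist] at l1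
  conv_lhs at l2 => rw [chainDist]
  simp only [iInf_lt_iff] at l1 l2
  obtain ⟨k, c, c0, ck, hc⟩ := l1
  obtain ⟨m, e, e0, em, he⟩ := l2
  rw [← chainDist] at hc
  have key : chainDist s a d ≤ ∑ i ∈ Finset.range k, classDist s (c i) (c (i + 1)) +
      ∑ i ∈ Finset.range m, classDist s (e i) (e (i + 1)) := by
    refine (chainDist_le s (k + m) (fun i => if i < k then c i else e (i - k)) ?_ ?_).trans
      (le_of_eq ?_)
    · by_cases hk : 0 < k
      · simp [hk, c0]
      · have : k = 0 := by omega
        subst this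
        simp [e0, ← c0, ck]
    · simp [em]
    · rw [Finset.sum_range_add]
      congr 1
      · refine Finset.sum_congr rfl fun i hi => ?_
        have hi' : i < k := Finset.mem_range.1 hi
        by_cases h : i + 1 < k
        · simp [hi', h]
        · have : i + 1 = k := by omega
          simp [hi', this, e0, ck]
      · refine Finset.sum_congr rfl fun i _ => ?_
        have h1 : ¬ (k + i < k) := by omega
        have h2 : ¬ (k + i + 1 < k) := by omega
        have h3 : k + i + 1 - k = i + 1 := by omega
        simp [h2, h3]
  calc chainDist s a d ≤ _ := key
    _ ≤ (chainDist s a b + (ε / 2 : NNReal)) + (chainDist s b d + (ε / 2 : NNReal)) :=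
        add_le_add hc.le he.le
    _ = chainDist s a b + chainDist s b d + ε := by
        rw [add_add_add_comm, ← ENNReal.coe_add, add_halves]

lemma chainDist_ne_top (s : Setoid X) (a b : MetricQuotient s) : chainDist s a b ≠ ⊤ := by
  obtain ⟨x, rfl⟩ : ∃ x, mk s x = a := Quotient.exists_rep a
  obtain ⟨y, rfl⟩ : ∃ y, mk s y = b := Quotient.exists_rep b
  have h1 : classDist s (mk s x) (mk s y) ≤ edist x y :=
    iInf_le_of_le x (iInf_le_of_le y (iInf_le_of_le rfl (iInf_le_of_le rfl le_rfl)))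
  have h2 := chainDist_le s 1 (fun i => if i = 0 then mk s x else mk s y) rfl rfl
  simp only [Finset.sum_range_one, zero_add, if_true, one_ne_zero, if_false] at h2
  exact ((h2.trans h1).trans_lt (edist_lt_top x y)).ne

/-- The quotient pseudo-metric: `edist a b = chainDist s a b`, and `dist a b` is the same
(finite) number as an element of `ℝ`. -/
instance (s : Setoid X) : PseudoMetricSpace (MetricQuotient s) :=
  letI : PseudoEMetricSpace (MetricQuotient s) :=
    { edist := chainDist s
      edist_self := chainDist_self s
      edist_comm := fun a b => le_antisymm (chainDist_comm_le s b a) (chainDist_comm_le s a b)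
      edist_triangle := chainDist_triangle s }
  PseudoEMetricSpace.toPseudoMetricSpace (chainDist_ne_top s)

lemma edist_def (s : Setoid X) (a b : MetricQuotient s) : edist a b = chainDist s a b := rfl

end MetricQuotient

/-- The equivalence relation which identifies all the points of `A` and no others. -/
def collapseSetoid {X : Type*} (A : Set X) : Setoid X where
  r x y := x = y ∨ (x ∈ A ∧ y ∈ A)
  iseqv :=
    { refl := fun _ => Or.inl rfl
      symm := by
        rintro x y (rfl | ⟨hx, hy⟩)
        · exact Or.inl rfl
        · exact Or.inr ⟨hy, hx⟩
      trans := by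
        rintro x y z (rfl | ⟨hx, hy⟩) (rfl | ⟨hy', hz⟩)
        · exact Or.inl rfl
        · exact Or.inr ⟨hy', hz⟩
        · exact Or.inr ⟨hx, hy⟩
        · exact Or.inr ⟨hx, hz⟩ }

/-- The space `X / A` obtained by collapsing `A` to a point, with the quotient pseudo-metric. -/
abbrev CollapsedSpace (A : Set X) : Type _ := MetricQuotient (collapseSetoid A)

/-- The projection `X → X / A`. -/
abbrev CollapsedSpace.proj (A : Set X) (x : X) : CollapsedSpace A :=
  MetricQuotient.mk (collapseSetoid A) x

end Quotients

/-! ### Leaves and the Hausdorff leaf space -/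

section Leaves

variable {E : Type*} [NormedAddCommGroup E] [NormedSpace ℝ E]
  {H : Type*} [TopologicalSpace H] (I : ModelWithCorners ℝ E H)
  {M : Type*} [MetricSpace M] [ChartedSpace H M]

/-- `x` and `y` are the endpoints of a `C^1` curve `c : [0, 1] → M` whose velocity vectors all
belong to `D` (where `D` is a field of tangent subspaces, seen as a subset of `TM`). -/
def TangentiallyJoined (D : Set (TangentBundle I M)) (x y : M) : Prop :=
  ∃ c : ℝ → M, ContMDiffOn 𝓘(ℝ, ℝ) I 1 c (Icc 0 1) ∧ c 0 = x ∧ c 1 = y ∧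
    ∀ s ∈ Icc (0 : ℝ) 1,
      tangentMapWithin 𝓘(ℝ, ℝ) I c (Icc 0 1) (⟨s, (1 : ℝ)⟩ : TangentBundle 𝓘(ℝ, ℝ) ℝ) ∈ D

/-- Two points are on the same leaf if they are joined by a piecewise `C^1` curve tangent to the
field `D`. When `D` is the tangent field of a foliation, the classes are the leaves of this
foliation. -/
def leafSetoid (D : Set (TangentBundle I M)) : Setoid M :=
  Relation.EqvGen.setoid (TangentiallyJoined I D)

/-- The space of leaves, with the pseudo-metric `ρ(L, L') = inf ∑ dist(Lᵢ, Lᵢ₊₁)` over all finite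
sequences of leaves from `L` to `L'`. -/
abbrev LeafSpace (D : Set (TangentBundle I M)) : Type _ := MetricQuotient (leafSetoid I D)

/-- The Hausdorff leaf space: the metric space obtained from the space of leaves by identifying
`L` and `L'` when `ρ(L, L') = 0`. -/
abbrev HausdorffLeafSpace (D : Set (TangentBundle I M)) : Type _ :=
  SeparationQuotient (LeafSpace I D)

/-- The natural projection of `M` onto the Hausdorff leaf space. -/
def hlsProj (D : Set (TangentBundle I M)) (x : M) : HausdorffLeafSpace I D :=
  SeparationQuotient.mk (MetricQuotient.mk (leafSetoid I D) x)

end Leaves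

/-! ### Codimension one foliations, transversals, and turbulization -/

section Turbulization

variable {n : ℕ} {H : Type*} [TopologicalSpace H]
  (I : ModelWithCorners ℝ (EuclideanSpace ℝ (Fin (n + 1))) H)
  (M : Type*) [MetricSpace M] [ChartedSpace H M]

/-- A smooth codimension one foliation, given by its tangent field: a field of hyperplanes
which is, locally, the field of kernels of the differential of a smooth submersion `u` into `ℝ`
(the level sets of `u` being the local leaves). -/
structure CodimOneFoliation where
  /-- the vectors tangent to the leaves -/
  tangent : Set (TangentBundle I M)
  exists_submersion : ∀ x : M, ∃ U : Set M, IsOpen U ∧ x ∈ U ∧ ∃ u : M → ℝ,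
    ContMDiffOn I 𝓘(ℝ, ℝ) ∞ u U ∧ ∀ y ∈ U, mfderiv I 𝓘(ℝ, ℝ) u y ≠ 0 ∧
      ∀ v : TangentSpace I y,
        (⟨y, v⟩ : TangentBundle I M) ∈ tangent ↔ mfderiv I 𝓘(ℝ, ℝ) u y v = 0

variable {I M}

/-- `γ` is a smooth closed curve (a `1`-periodic map on `ℝ`) nowhere tangent to the foliation. -/
structure IsClosedTransversal (F : CodimOneFoliation I M) (γ : ℝ → M) : Prop where
  smooth : ContMDiff 𝓘(ℝ, ℝ) I ∞ γ
  periodic : Function.Periodic γ 1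
  transversal : ∀ t : ℝ,
    tangentMap 𝓘(ℝ, ℝ) I γ (⟨t, (1 : ℝ)⟩ : TangentBundle 𝓘(ℝ, ℝ) ℝ) ∉ F.tangent

/-- The product of the unit disc of `ℝⁿ` with `ℝ`, the domain of the coordinates `(x, t)`. -/
def tubeDomain (n : ℕ) : Set (EuclideanSpace ℝ (Fin n) × ℝ) :=
  Metric.ball 0 1 ×ˢ univ

/-- `Φ` is a foliated tubular neighbourhood `Dⁿ × S¹ → M` of the closed transversal `γ`, where
`S¹ = ℝ / ℤ`: an open embedding of `Dⁿ × ℝ / ℤ` which maps `(0, t)` to `γ t` and under which the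
foliation is the product foliation by the discs `Dⁿ × {t}`. -/
structure IsFoliatedTube (F : CodimOneFoliation I M) (γ : ℝ → M)
    (Φ : EuclideanSpace ℝ (Fin n) × ℝ → M) : Prop where
  localDiffeo : IsLocalDiffeomorphOn 𝓘(ℝ, EuclideanSpace ℝ (Fin n) × ℝ) I ∞ Φ (tubeDomain n)
  eq_iff : ∀ p ∈ tubeDomain n, ∀ q ∈ tubeDomain n,
    Φ p = Φ q ↔ p.1 = q.1 ∧ ∃ k : ℤ, q.2 = p.2 + k
  core : ∀ t : ℝ, Φ (0, t) = γ t
  foliated : ∀ p ∈ tubeDomain n, ∀ v : EuclideanSpace ℝ (Fin n) × ℝ,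
    tangentMap 𝓘(ℝ, EuclideanSpace ℝ (Fin n) × ℝ) I Φ ⟨p, v⟩ ∈ F.tangent ↔ v.2 = 0

/-- The profile function `λ : [0, 1] → [-π/2, π/2]` of a turbulization. -/
structure IsTurbulizationProfile (lam : ℝ → ℝ) : Prop where
  smooth : ContDiffOn ℝ ∞ lam (Icc 0 1)
  mapsTo : MapsTo lam (Icc 0 1) (Icc (-(Real.pi / 2)) (Real.pi / 2))
  strictMono : StrictMonoOn lam (Icc 0 (3 / 4))
  at_zero : lam 0 = -(Real.pi / 2)
  at_two_thirds : lam (2 / 3) = 0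
  eq_of_ge : ∀ r ∈ Icc (3 / 4 : ℝ) 1, lam r = Real.pi / 2
  flat : ∀ k : ℕ, 1 ≤ k → iteratedDerivWithin k lam (Icc 0 1) 0 = 0

/-- The `1`-form `ω = cos λ(r) dr + sin λ(r) dt` at the point `p = (x, t)`, where `r = ‖x‖`, so that
`dr(v) = ⟪x, v⟫ / ‖x‖`. At `x = 0` the first term is `0`, as it should be since `cos λ(0) = 0`. -/
def turbulizationForm (lam : ℝ → ℝ) (p v : EuclideanSpace ℝ (Fin n) × ℝ) : ℝ :=
  Real.cos (lam ‖p.1‖) * (inner ℝ p.1 v.1 / ‖p.1‖) + Real.sin (lam ‖p.1‖) * v.2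

/-- The tangent field of the turbulized foliation: the kernel of `ω` in the tube, and the field of
the original foliation at the points outside of the tube. -/
def turbulizedField (F : CodimOneFoliation I M) (Φ : EuclideanSpace ℝ (Fin n) × ℝ → M)
    (lam : ℝ → ℝ) : Set (TangentBundle I M) :=
  {w | w ∈ F.tangent ∧ w.proj ∉ Φ '' tubeDomain n} ∪
  {w | ∃ p ∈ tubeDomain n, ∃ v : EuclideanSpace ℝ (Fin n) × ℝ, turbulizationForm lam p v = 0 ∧
    w = tangentMap 𝓘(ℝ, EuclideanSpace ℝ (Fin n) × ℝ) I Φ ⟨p, v⟩}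

end Turbulization

end

/-!
The Hausdorff leaf space of a field is the largest metric quotient of `M` whose projection does not
increase distances and is constant along the curves tangent to the field
(`exists_lift_hlsProj`). Collapsing a closed set `A` has the same kind of universal property
(`MetricQuotient.exists_lift`), and leaves a genuine metric space (`CollapsedSpace.t0Space`). The
isometry therefore exists as soon as each of the two projections of `M` factors through the other
one (`exists_isometryEquiv_collapsed`): the projection to `HLS(F_γ)` has to be constant along the
curves tangent to `F` and on the points whose class lies in `π(γ)`, and the projection to
`HLS(F) / π(γ)` has to be constant along the curves tangent to `F_γ`.

The two fields agree off the closed core `r ≤ 3/4` of the tube. Along a curve tangent to one of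
them, a projection which is constant on the leaves of the other one and on the open tube is locally
constant, hence constant (`eq_of_tangentiallyJoined`). It remains to see that each projection maps
the whole tube to one point.

* In `HLS(F) / π(γ)` this holds because every disc `Dⁿ × {t}` lies in a leaf of `F` and meets `γ`
  (`IsFoliatedTube.hlsProj_mem_image_of_mem_tube`).
* In `HLS(F_γ)`, fix a unit vector `θ`. The leaf of `F_γ` through `(r θ, t)`, `r ≠ 2/3`, contains the
  curve along which `dt/dr = - cot λ(r)`, which can be followed until `r` is as near to `2/3` as one
  likes (`IsFoliatedTube.exists_joined_spiral`). It thus comes arbitrarily near to the circle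
  `{2/3 θ} × S¹`, which is tangent to `F_γ`, so that both have the same class
  (`IsFoliatedTube.hlsProj_eq_circle`); the divergence of the integral of `cot λ` is not needed for
  this. Letting `r` tend to `0` shows that all these classes, for all `θ`, are the class of the axis
  (`IsFoliatedTube.hlsProj_eq_axis`).
-/

/-! ### The universal property of quotient pseudo-metrics -/

namespace MetricQuotient

lemma mk_surjective {X : Type*} (s : Setoid X) : Function.Surjective (mk s) :=
  fun a => Quotient.exists_rep a

lemma mk_eq_mk {X : Type*} (s : Setoid X) {x y : X} : mk s x = mk s y ↔ s x y := Quotient.eq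

variable {X : Type*} [PseudoMetricSpace X] (s : Setoid X)

lemma edist_mk_le (x y : X) : edist (mk s x) (mk s y) ≤ edist x y := by
  have h1 : classDist s (mk s x) (mk s y) ≤ edist x y :=
    iInf_le_of_le x (iInf_le_of_le y (iInf_le_of_le rfl (iInf_le_of_le rfl le_rfl)))
  have h2 := chainDist_le s 1 (fun i => if i = 0 then mk s x else mk s y) rfl rfl
  simp only [Finset.sum_range_one, zero_add, if_true, one_ne_zero, if_false] at h2
  exact h2.trans h1

lemma lipschitzWith_mk : LipschitzWith 1 (mk s) :=
  LipschitzWith.mk_one fun x y => by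
    rw [dist_edist, dist_edist]
    exact ENNReal.toReal_mono (edist_ne_top x y) (edist_mk_le s x y)

/-- The quotient pseudo-metric is the largest one for which the projection does not increase
distances: a `1`-Lipschitz map which is constant on the classes stays `1`-Lipschitz on the
quotient. -/
lemma exists_lift {Y : Type*} [PseudoMetricSpace Y] {g : X → Y} (hg : LipschitzWith 1 g)
    (hs : ∀ x y, s x y → g x = g y) :
    ∃ G : MetricQuotient s → Y, LipschitzWith 1 G ∧ ∀ x, G (mk s x) = g x := by
  let G : MetricQuotient s → Y := Quotient.lift g hs
  have hG : ∀ x, G (mk s x) = g x := fun x => rfl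
  refine ⟨G, fun a b => ?_, hG⟩
  rw [edist_def, ENNReal.coe_one, one_mul]
  have hclass : ∀ a b, edist (G a) (G b) ≤ classDist s a b := by
    intro a b
    refine le_iInf fun x => le_iInf fun y => le_iInf fun hx => le_iInf fun hy => ?_
    rw [← hx, ← hy, hG, hG]
    simpa using hg x y
  refine le_iInf fun k => le_iInf fun c => le_iInf fun h0 => le_iInf fun hk => ?_
  rw [← h0, ← hk]
  exact (edist_le_range_sum_edist (fun i => G (c i)) k).trans
    (Finset.sum_le_sum fun i _ => hclass _ _)

end MetricQuotient

/-- Collapsing a closed subset of a metric space does not create distinct points at distance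
zero. -/
lemma CollapsedSpace.t0Space {X : Type*} [MetricSpace X] {A : Set X} (hA : IsClosed A) :
    T0Space (CollapsedSpace A) := by
  -- The truncated distance to a point `x` outside of `A` is constant on `A`, hence descends to the
  -- quotient, and it separates `x` from all the other points.
  have key : ∀ x y : X, x ∉ A → dist (proj A x) (proj A y) = 0 → x = y := by
    intro x y hx hxy
    obtain ⟨δ, hδ, hball⟩ := Metric.isOpen_iff.1 hA.isOpen_compl x hx
    have hfar : ∀ z ∈ A, δ ≤ dist z x := fun z hz => not_lt.1 fun h => hball h hz
    obtain ⟨G, hG, hGx⟩ := MetricQuotient.exists_lift (collapseSetoid A)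
      (g := fun z => min (dist z x) δ) ((LipschitzWith.dist_left x).min_const δ) (by
        rintro z w (rfl | ⟨hz, hw⟩)
        · rfl
        · simp only [min_eq_right (hfar z hz), min_eq_right (hfar w hw)])
    have h := hG.dist_le_mul (proj A x) (proj A y)
    rw [hxy, mul_zero, hGx, hGx, dist_self, min_eq_left hδ.le, Real.dist_eq] at h
    have h' : min (dist y x) δ = 0 := by
      have := abs_eq_zero.1 (le_antisymm h (abs_nonneg _))
      linarith
    rcases min_eq_iff.1 h' with ⟨h0, _⟩ | ⟨h0, _⟩
    · exact (dist_eq_zero.1 h0).symm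
    · exact absurd h0 hδ.ne'
  refine ⟨fun a b hab => ?_⟩
  obtain ⟨x, rfl⟩ := MetricQuotient.mk_surjective _ a
  obtain ⟨y, rfl⟩ := MetricQuotient.mk_surjective _ b
  have hxy := Metric.inseparable_iff.1 hab
  by_cases hx : x ∈ A
  · by_cases hy : y ∈ A
    · exact (MetricQuotient.mk_eq_mk _).2 (Or.inr ⟨hx, hy⟩)
    · exact congrArg _ (key y x hy (by rw [dist_comm]; exact hxy)).symm
  · exact congrArg _ (key x y hx hxy)

section HausdorffLeafSpace

variable {E : Type*} [NormedAddCommGroup E] [NormedSpace ℝ E]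
  {H : Type*} [TopologicalSpace H] {I : ModelWithCorners ℝ E H}
  {M : Type*} [MetricSpace M] [ChartedSpace H M]

lemma hlsProj_surjective (D : Set (TangentBundle I M)) : Function.Surjective (hlsProj I D) :=
  SeparationQuotient.surjective_mk.comp (MetricQuotient.mk_surjective _)

lemma lipschitzWith_hlsProj (D : Set (TangentBundle I M)) : LipschitzWith 1 (hlsProj I D) := by
  refine LipschitzWith.mk_one fun x y => ?_
  rw [hlsProj, hlsProj, SeparationQuotient.dist_mk]
  simpa using (MetricQuotient.lipschitzWith_mk (leafSetoid I D)).dist_le_mul x y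

lemma hlsProj_eq_of_joined {D : Set (TangentBundle I M)} {x y : M}
    (h : TangentiallyJoined I D x y) : hlsProj I D x = hlsProj I D y :=
  congrArg SeparationQuotient.mk ((MetricQuotient.mk_eq_mk _).2 (Relation.EqvGen.rel _ _ h))

/-- The universal property of the Hausdorff leaf space: a `1`-Lipschitz map to a separated space
which is constant along the curves tangent to `D` descends to a `1`-Lipschitz map. -/
lemma exists_lift_hlsProj {Y : Type*} [PseudoMetricSpace Y] [T0Space Y]
    {D : Set (TangentBundle I M)} {g : M → Y} (hg : LipschitzWith 1 g)
    (hD : ∀ x y, TangentiallyJoined I D x y → g x = g y) :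
    ∃ G : HausdorffLeafSpace I D → Y, LipschitzWith 1 G ∧ ∀ x, G (hlsProj I D x) = g x := by
  obtain ⟨G, hG, hGx⟩ := MetricQuotient.exists_lift (leafSetoid I D) hg (by
    intro x y h
    change Relation.EqvGen _ x y at h
    induction h with
    | rel x y h => exact hD x y h
    | refl x => rfl
    | symm x y _ ih => exact ih.symm
    | trans x y z _ _ ih₁ ih₂ => exact ih₁.trans ih₂)
  have hins : ∀ a b, Inseparable a b → G a = G b := fun a b h => (h.map hG.continuous).eq
  refine ⟨SeparationQuotient.lift G hins, ?_, hGx⟩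
  refine LipschitzWith.mk_one fun a b => ?_
  obtain ⟨a, rfl⟩ := SeparationQuotient.surjective_mk a
  obtain ⟨b, rfl⟩ := SeparationQuotient.surjective_mk b
  rw [SeparationQuotient.dist_mk]
  simpa using hG.dist_le_mul a b

/-- Two Hausdorff leaf spaces of the same manifold, the first one with a closed set collapsed, agree
as soon as each projection is constant along the curves tangent to the other field: both are
the largest quotient for which the projection of `M` does not increase distances. -/
lemma exists_isometryEquiv_collapsed {D D' : Set (TangentBundle I M)}
    {A : Set (HausdorffLeafSpace I D)} (hA : IsClosed A)
    (hD : ∀ x y, TangentiallyJoined I D x y → hlsProj I D' x = hlsProj I D' y)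
    (hAD' : ∀ x y, hlsProj I D x ∈ A → hlsProj I D y ∈ A → hlsProj I D' x = hlsProj I D' y)
    (hD' : ∀ x y, TangentiallyJoined I D' x y →
      CollapsedSpace.proj A (hlsProj I D x) = CollapsedSpace.proj A (hlsProj I D y)) :
    ∃ f : CollapsedSpace A ≃ᵢ HausdorffLeafSpace I D',
      ∀ x : M, f (CollapsedSpace.proj A (hlsProj I D x)) = hlsProj I D' x := by
  have := CollapsedSpace.t0Space hA
  obtain ⟨f₀, hf₀, hf₀x⟩ := exists_lift_hlsProj (lipschitzWith_hlsProj D') hD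
  obtain ⟨f, hf, hfx⟩ := MetricQuotient.exists_lift (collapseSetoid A) hf₀ (by
    rintro a b (rfl | ⟨ha, hb⟩)
    · rfl
    · obtain ⟨x, rfl⟩ := hlsProj_surjective D a
      obtain ⟨y, rfl⟩ := hlsProj_surjective D b
      rw [hf₀x, hf₀x]
      exact hAD' x y ha hb)
  obtain ⟨g, hg, hgx⟩ := exists_lift_hlsProj (D := D')
    (g := fun x => CollapsedSpace.proj A (hlsProj I D x))
    (mul_one (1 : NNReal) ▸
      (MetricQuotient.lipschitzWith_mk (collapseSetoid A)).comp (lipschitzWith_hlsProj D)) hD'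
  have hfx' : ∀ x, f (CollapsedSpace.proj A (hlsProj I D x)) = hlsProj I D' x := fun x => by
    rw [hfx, hf₀x]
  have hgf : ∀ a, g (f a) = a := by
    intro a
    obtain ⟨b, rfl⟩ := MetricQuotient.mk_surjective _ a
    obtain ⟨x, rfl⟩ := hlsProj_surjective D b
    rw [hfx', hgx]
  have hfg : ∀ b, f (g b) = b := by
    intro b
    obtain ⟨x, rfl⟩ := hlsProj_surjective D' b
    rw [hgx, hfx']
  have hiso : Isometry f := by
    refine Isometry.of_dist_eq fun a b => le_antisymm ?_ ?_
    · simpa using hf.dist_le_mul a b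
    · simpa [hgf] using hg.dist_le_mul (f a) (f b)
  exact ⟨⟨⟨f, g, hgf, hfg⟩, hiso⟩, hfx'⟩

end HausdorffLeafSpace

/-! ### Curves tangent to a field of tangent subspaces -/

section TangentCurves

variable {E : Type*} [NormedAddCommGroup E] [NormedSpace ℝ E]
  {H : Type*} [TopologicalSpace H] {I : ModelWithCorners ℝ E H}
  {M : Type*} [MetricSpace M] [ChartedSpace H M]

lemma tangentMapWithin_Icc_eq {c : ℝ → M} {s : ℝ} (hs : s ∈ Icc (0 : ℝ) 1)
    {L : TangentSpace 𝓘(ℝ, ℝ) s →L[ℝ] TangentSpace I (c s)}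
    (h : HasMFDerivWithinAt 𝓘(ℝ, ℝ) I c (Icc 0 1) s L) :
    tangentMapWithin 𝓘(ℝ, ℝ) I c (Icc 0 1) (⟨s, (1 : ℝ)⟩ : TangentBundle 𝓘(ℝ, ℝ) ℝ) =
      ⟨c s, L (1 : ℝ)⟩ := by
  have hu : UniqueMDiffWithinAt 𝓘(ℝ, ℝ) (Icc (0 : ℝ) 1) s :=
    (uniqueDiffOn_Icc zero_lt_one s hs).uniqueMDiffWithinAt
  simp only [tangentMapWithin, h.mfderivWithin hu]

/-- The endpoints of a piece of a `C^1` curve are joined by a curve tangent to `D` when this piece is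
tangent to `D`. The affine reparametrization rescales the velocities. -/
lemma tangentiallyJoined_of_subcurve {D : Set (TangentBundle I M)}
    (hD : ∀ (x : M) (v : TangentSpace I x) (r : ℝ),
      (⟨x, v⟩ : TangentBundle I M) ∈ D → (⟨x, r • v⟩ : TangentBundle I M) ∈ D)
    {c : ℝ → M} (hc : ContMDiffOn 𝓘(ℝ, ℝ) I 1 c (Icc 0 1)) {a b : ℝ}
    (ha : a ∈ Icc (0 : ℝ) 1) (hb : b ∈ Icc (0 : ℝ) 1)
    (htan : ∀ s ∈ segment ℝ a b,
      tangentMapWithin 𝓘(ℝ, ℝ) I c (Icc 0 1) (⟨s, (1 : ℝ)⟩ : TangentBundle 𝓘(ℝ, ℝ) ℝ) ∈ D) :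
    TangentiallyJoined I D (c a) (c b) := by
  have hσ : ContDiff ℝ 1 (fun s : ℝ => a + s * (b - a)) := by fun_prop
  have hmem : ∀ s ∈ Icc (0 : ℝ) 1, a + s * (b - a) ∈ segment ℝ a b := fun s hs => by
    rw [segment_eq_image']
    exact ⟨s, hs, rfl⟩
  have hmaps : MapsTo (fun s : ℝ => a + s * (b - a)) (Icc 0 1) (Icc 0 1) := fun s hs =>
    (convex_Icc (0 : ℝ) 1).segment_subset ha hb (hmem s hs)
  refine ⟨fun s => c (a + s * (b - a)), hc.comp hσ.contMDiff.contMDiffOn hmaps, by simp, by simp,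
    fun s hs => ?_⟩
  have h1 := ((hc.mdifferentiableOn one_ne_zero) _ (hmaps hs)).hasMFDerivWithinAt
  have h2 : HasDerivAt (fun s : ℝ => a + s * (b - a)) (b - a) s := by
    simpa using ((hasDerivAt_id s).mul_const (b - a)).const_add a
  have h3 := h1.comp s h2.hasFDerivAt.hasFDerivWithinAt.hasMFDerivWithinAt hmaps
  have h4 := tangentMapWithin_Icc_eq hs h3
  have h5 := hD _ _ (b - a) (htan _ (hmem s hs))
  refine (congrArg (· ∈ D) ?_).mpr h5
  refine h4.trans ?_
  refine congrArg (fun v => (⟨c (a + s * (b - a)), v⟩ : TangentBundle I M)) ?_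
  refine Eq.trans ?_ (map_smul (mfderivWithin 𝓘(ℝ, ℝ) I c (Icc 0 1) (a + s * (b - a)))
    (b - a) (1 : ℝ))
  refine congrArg (mfderivWithin 𝓘(ℝ, ℝ) I c (Icc 0 1) (a + s * (b - a))) ?_
  exact (one_smul ℝ (b - a)).trans (mul_one (b - a)).symm

/-- Suppose that a function `g` is constant on the open set `T` and along the curves tangent to `D'`,
and that `D ⊆ D'` off a closed subset `K` of `T`. Then `g` is locally constant, hence constant, along
every curve tangent to `D`. -/
lemma eq_of_tangentiallyJoined {Y : Type*} {g : M → Y} {D D' : Set (TangentBundle I M)}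
    {K T : Set M} (hT : IsOpen T) (hK : IsClosed K) (hKT : K ⊆ T)
    (hgT : ∀ x ∈ T, ∀ y ∈ T, g x = g y)
    (hDD' : ∀ w ∈ D, w.proj ∉ K → w ∈ D')
    (hD' : ∀ (x : M) (v : TangentSpace I x) (r : ℝ),
      (⟨x, v⟩ : TangentBundle I M) ∈ D' → (⟨x, r • v⟩ : TangentBundle I M) ∈ D')
    (hg : ∀ x y, TangentiallyJoined I D' x y → g x = g y)
    {x y : M} (hxy : TangentiallyJoined I D x y) : g x = g y := by
  obtain ⟨c, hc, rfl, rfl, htan⟩ := hxy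
  have hcont : Continuous (fun s : Icc (0 : ℝ) 1 => c s) :=
    continuousOn_iff_continuous_domRestrict.1 hc.continuousOn
  have hloc : IsLocallyConstant (fun s : Icc (0 : ℝ) 1 => g (c s)) := by
    refine (IsLocallyConstant.iff_eventually_eq _).2 fun s => ?_
    by_cases hs : c s ∈ T
    · filter_upwards [(hT.preimage hcont).mem_nhds hs] with t ht
      exact hgT _ ht _ hs
    · obtain ⟨ε, hε, hball⟩ := Metric.isOpen_iff.1 (hK.isOpen_compl.preimage hcont) s
        fun h => hs (hKT h)
      filter_upwards [Metric.ball_mem_nhds s hε] with t ht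
      refine hg _ _ (tangentiallyJoined_of_subcurve hD' hc t.2 s.2 fun u hu => ?_)
      have hu01 : u ∈ Icc (0 : ℝ) 1 := (convex_Icc (0 : ℝ) 1).segment_subset t.2 s.2 hu
      have huball : u ∈ Metric.ball (s : ℝ) ε :=
        (convex_ball (s : ℝ) ε).segment_subset ht (Metric.mem_ball_self hε) hu
      exact hDD' _ (htan u hu01) (hball (show (⟨u, hu01⟩ : Icc (0 : ℝ) 1) ∈ _ from huball))
  exact hloc.apply_eq_of_preconnectedSpace ⟨0, by simp⟩ ⟨1, by simp⟩

/-- A curve in a region mapped into `M` by a differentiable map `Φ` gives a tangent curve of `M`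
if `Φ` maps its velocity vectors into `D`. -/
lemma tangentiallyJoined_map {V : Type*} [NormedAddCommGroup V] [NormedSpace ℝ V]
    {D : Set (TangentBundle I M)} {Φ : V → M} {U : Set V} (hU : IsOpen U)
    (hΦ : ContMDiffOn 𝓘(ℝ, V) I 1 Φ U) {q q' : ℝ → V} (hq : ContDiff ℝ 1 q)
    (hq' : ∀ s, HasDerivAt q (q' s) s) (hqU : ∀ s ∈ Icc (0 : ℝ) 1, q s ∈ U)
    (htan : ∀ s ∈ Icc (0 : ℝ) 1, tangentMap 𝓘(ℝ, V) I Φ ⟨q s, q' s⟩ ∈ D) :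
    TangentiallyJoined I D (Φ (q 0)) (Φ (q 1)) := by
  refine ⟨fun s => Φ (q s), hΦ.comp hq.contMDiff.contMDiffOn hqU, rfl, rfl, fun s hs => ?_⟩
  have h1 : HasMFDerivAt 𝓘(ℝ, V) I Φ (q s) (mfderiv 𝓘(ℝ, V) I Φ (q s)) :=
    ((hΦ.mdifferentiableOn one_ne_zero).mdifferentiableAt (hU.mem_nhds (hqU s hs))).hasMFDerivAt
  have h3 := h1.comp_hasMFDerivWithinAt s
    (hq' s).hasFDerivAt.hasFDerivWithinAt.hasMFDerivWithinAt (s := Icc 0 1)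
  refine (congrArg (· ∈ D) ?_).mpr (htan s hs)
  refine (tangentMapWithin_Icc_eq hs h3).trans ?_
  refine congrArg (fun v => (⟨Φ (q s), v⟩ : TangentBundle I M)) ?_
  refine congrArg (mfderiv 𝓘(ℝ, V) I Φ (q s)) ?_
  exact one_smul ℝ (q' s)

end TangentCurves

/-! ### The turbulized foliation in the tube -/

section Tube

variable {n : ℕ} {H : Type*} [TopologicalSpace H]
  {I : ModelWithCorners ℝ (EuclideanSpace ℝ (Fin (n + 1))) H}
  {M : Type*} [MetricSpace M] [ChartedSpace H M]
  {F : CodimOneFoliation I M} {γ : ℝ → M} {Φ : EuclideanSpace ℝ (Fin n) × ℝ → M}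
  {lam : ℝ → ℝ}

lemma isOpen_tubeDomain (n : ℕ) : IsOpen (tubeDomain n) := Metric.isOpen_ball.prod isOpen_univ

lemma mem_tubeDomain {p : EuclideanSpace ℝ (Fin n) × ℝ} : p ∈ tubeDomain n ↔ ‖p.1‖ < 1 := by
  simp [tubeDomain]

lemma CodimOneFoliation.smul_mem_tangent (F : CodimOneFoliation I M) (x : M)
    (v : TangentSpace I x) (r : ℝ) (hv : (⟨x, v⟩ : TangentBundle I M) ∈ F.tangent) :
    (⟨x, r • v⟩ : TangentBundle I M) ∈ F.tangent := by
  obtain ⟨U, -, hxU, u, -, hu⟩ := F.exists_submersion x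
  rw [(hu x hxU).2] at hv ⊢
  refine (map_smul (mfderiv I 𝓘(ℝ, ℝ) u x) r v).trans ?_
  rw [hv, smul_zero]

lemma turbulizationForm_smul (p v : EuclideanSpace ℝ (Fin n) × ℝ) (r : ℝ) :
    turbulizationForm lam p (r • v) = r * turbulizationForm lam p v := by
  simp only [turbulizationForm, Prod.smul_fst, Prod.smul_snd, inner_smul_right, smul_eq_mul]
  ring

lemma smul_mem_turbulizedField (x : M) (v : TangentSpace I x) (r : ℝ)
    (hv : (⟨x, v⟩ : TangentBundle I M) ∈ turbulizedField F Φ lam) :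
    (⟨x, r • v⟩ : TangentBundle I M) ∈ turbulizedField F Φ lam := by
  rcases hv with ⟨hv, hx⟩ | ⟨p, hp, w, hw, hpw⟩
  · exact Or.inl ⟨F.smul_mem_tangent x v r hv, hx⟩
  · refine Or.inr ⟨p, hp, r • w, by rw [turbulizationForm_smul, hw, mul_zero], ?_⟩
    cases hpw
    exact congrArg (fun u => (⟨Φ p, u⟩ : TangentBundle I M)) (map_smul (mfderiv _ I Φ p) r w).symm

/-- The closed core of the tube, which contains all the points at which the turbulization changes
the foliation. -/
def tubeCore {M : Type*} (Φ : EuclideanSpace ℝ (Fin n) × ℝ → M) : Set M :=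
  Φ '' (Metric.closedBall 0 (3 / 4) ×ˢ univ)

lemma core_subset_tubeDomain :
    (Metric.closedBall 0 (3 / 4) ×ˢ univ : Set (EuclideanSpace ℝ (Fin n) × ℝ)) ⊆ tubeDomain n :=
  prod_mono (Metric.closedBall_subset_ball (by norm_num)) subset_rfl

namespace IsFoliatedTube

lemma contMDiffOn (hΦ : IsFoliatedTube F γ Φ) :
    ContMDiffOn 𝓘(ℝ, EuclideanSpace ℝ (Fin n) × ℝ) I 1 Φ (tubeDomain n) :=
  hΦ.localDiffeo.contMDiffOn.of_le (by norm_num)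

lemma isOpen_image (hΦ : IsFoliatedTube F γ Φ) : IsOpen (Φ '' tubeDomain n) := by
  rw [isOpen_iff_mem_nhds]
  rintro _ ⟨p, hp, rfl⟩
  rw [← hΦ.localDiffeo.isLocalHomeomorphOn.map_nhds_eq hp]
  exact Filter.image_mem_map ((isOpen_tubeDomain n).mem_nhds hp)

lemma map_fract (hΦ : IsFoliatedTube F γ Φ) {x : EuclideanSpace ℝ (Fin n)} (hx : ‖x‖ < 1)
    (t : ℝ) : Φ (x, Int.fract t) = Φ (x, t) :=
  (hΦ.eq_iff (x, Int.fract t) (mem_tubeDomain.2 hx) (x, t) (mem_tubeDomain.2 hx)).2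
    ⟨rfl, ⌊t⌋, (Int.fract_add_floor t).symm⟩

lemma isClosed_tubeCore (hΦ : IsFoliatedTube F γ Φ) : IsClosed (tubeCore Φ) := by
  have h : tubeCore Φ = Φ '' (Metric.closedBall 0 (3 / 4) ×ˢ Icc 0 1) := by
    refine Subset.antisymm ?_ (image_mono (prod_mono subset_rfl (subset_univ _)))
    rintro _ ⟨⟨x, t⟩, hp, rfl⟩
    refine ⟨(x, Int.fract t), ⟨hp.1, Int.fract_nonneg t, (Int.fract_lt_one t).le⟩, ?_⟩
    exact hΦ.map_fract (mem_tubeDomain.1 (core_subset_tubeDomain hp)) t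
  rw [h]
  exact (((isCompact_closedBall _ _).prod isCompact_Icc).image_of_continuousOn
    (hΦ.contMDiffOn.continuousOn.mono
      ((prod_mono subset_rfl (subset_univ _)).trans core_subset_tubeDomain))).isClosed

lemma tubeCore_subset {M : Type*} {Φ : EuclideanSpace ℝ (Fin n) × ℝ → M} :
    tubeCore Φ ⊆ Φ '' tubeDomain n := image_mono core_subset_tubeDomain

/-- Each disc `Dⁿ × {t}` is contained in one leaf of the original foliation. -/
lemma joined_disc (hΦ : IsFoliatedTube F γ Φ) {p : EuclideanSpace ℝ (Fin n) × ℝ}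
    (hp : p ∈ tubeDomain n) : TangentiallyJoined I F.tangent (γ p.2) (Φ p) := by
  have h := tangentiallyJoined_map (D := F.tangent) (isOpen_tubeDomain n) hΦ.contMDiffOn
    (q := fun s : ℝ => (s • p.1, p.2)) (q' := fun _ => (p.1, 0)) (by fun_prop)
    (fun s => by
      simpa using ((hasDerivAt_id s).smul_const p.1).prodMk (hasDerivAt_const s p.2))
  have hmem : ∀ s ∈ Icc (0 : ℝ) 1, ((s • p.1, p.2) : EuclideanSpace ℝ (Fin n) × ℝ) ∈
      tubeDomain n := fun s hs => by
    rw [mem_tubeDomain] at hp ⊢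
    rw [norm_smul, Real.norm_of_nonneg hs.1]
    exact (mul_le_of_le_one_left (norm_nonneg _) hs.2).trans_lt hp
  have h' := h hmem fun s hs => (hΦ.foliated _ (hmem s hs) _).2 rfl
  simpa [hΦ.core] using h'

lemma mem_tangent_of_mem_turbulizedField (hΦ : IsFoliatedTube F γ Φ)
    (hlam : IsTurbulizationProfile lam) {w : TangentBundle I M}
    (hw : w ∈ turbulizedField F Φ lam) (hwK : w.proj ∉ tubeCore Φ) : w ∈ F.tangent := by
  rcases hw with ⟨hw, -⟩ | ⟨p, hp, v, hv, rfl⟩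
  · exact hw
  · refine (hΦ.foliated p hp v).2 ?_
    have hr : 3 / 4 ≤ ‖p.1‖ := by
      by_contra! h
      exact hwK ⟨p, ⟨by simpa using h.le, mem_univ _⟩, rfl⟩
    have hl := hlam.eq_of_ge _ ⟨hr, (mem_tubeDomain.1 hp).le⟩
    simpa [turbulizationForm, hl] using hv

lemma mem_turbulizedField_of_mem_tangent (hΦ : IsFoliatedTube F γ Φ)
    (hlam : IsTurbulizationProfile lam) {w : TangentBundle I M}
    (hw : w ∈ F.tangent) (hwK : w.proj ∉ tubeCore Φ) : w ∈ turbulizedField F Φ lam := by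
  by_cases hwT : w.proj ∈ Φ '' tubeDomain n
  · obtain ⟨x, u⟩ := w
    obtain ⟨p, hp, rfl⟩ := hwT
    -- `dΦ` is onto at `p`, so that `u` can be read in the coordinates of the tube.
    obtain ⟨v, rfl⟩ := ((hΦ.localDiffeo ⟨p, hp⟩).mfderivToContinuousLinearEquiv
      (by simp)).surjective u
    have hr : 3 / 4 ≤ ‖p.1‖ := by
      by_contra! h
      exact hwK ⟨p, ⟨by simpa using h.le, mem_univ _⟩, rfl⟩
    have hl := hlam.eq_of_ge _ ⟨hr, (mem_tubeDomain.1 hp).le⟩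
    have hv : v.2 = 0 := (hΦ.foliated p hp v).1 hw
    exact Or.inr ⟨p, hp, v, by simp [turbulizationForm, hl, hv], rfl⟩
  · exact Or.inl ⟨hw, hwT⟩

/-- A curve in the tube which is annihilated by `ω` joins points of the same turbulized leaf. -/
lemma joined_turbulizedField (hΦ : IsFoliatedTube F γ Φ)
    {q q' : ℝ → EuclideanSpace ℝ (Fin n) × ℝ} (hq : ContDiff ℝ 1 q)
    (hq' : ∀ s, HasDerivAt q (q' s) s) (hqU : ∀ s ∈ Icc (0 : ℝ) 1, q s ∈ tubeDomain n)
    (hω : ∀ s ∈ Icc (0 : ℝ) 1, turbulizationForm lam (q s) (q' s) = 0) :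
    TangentiallyJoined I (turbulizedField F Φ lam) (Φ (q 0)) (Φ (q 1)) :=
  tangentiallyJoined_map (isOpen_tubeDomain n) hΦ.contMDiffOn hq hq' hqU
    fun s hs => Or.inr ⟨q s, hqU s hs, q' s, hω s hs, rfl⟩

end IsFoliatedTube
end Tube

/-! ### The turbulized leaves accumulate on the torus `r = 2/3` -/

/-- A continuous function on `[0, 1]` has a primitive with given initial value, which can be chosen
of class `C^1` on the whole line. -/
lemma exists_primitive_Icc {f : ℝ → ℝ} (hf : ContinuousOn f (Icc 0 1)) (t₀ : ℝ) :
    ∃ T T' : ℝ → ℝ, ContDiff ℝ 1 T ∧ T 0 = t₀ ∧ (∀ s, HasDerivAt T (T' s) s) ∧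
      ∀ s ∈ Icc (0 : ℝ) 1, T' s = f s := by
  let g : ℝ → ℝ := IccExtend zero_le_one ((Icc (0 : ℝ) 1).domRestrict f)
  have hg : Continuous g := hf.domRestrict.Icc_extend'
  have hder : ∀ s, HasDerivAt (fun s => t₀ + ∫ u in (0 : ℝ)..s, g u) (g s) s := fun s =>
    (hg.integral_hasStrictDerivAt 0 s).hasDerivAt.const_add t₀
  refine ⟨_, g, contDiff_one_iff_deriv.2 ⟨fun s => (hder s).differentiableAt, ?_⟩, by simp, hder,
    fun s hs => IccExtend_of_mem zero_le_one _ hs⟩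
  rw [show deriv _ = g from funext fun s => (hder s).deriv]
  exact hg

lemma IsTurbulizationProfile.sin_ne_zero {lam : ℝ → ℝ} (hlam : IsTurbulizationProfile lam) {r : ℝ}
    (hr : r ∈ Icc (0 : ℝ) 1) (hne : r ≠ 2 / 3) : Real.sin (lam r) ≠ 0 := by
  have hmem := hlam.mapsTo hr
  have hpi := Real.pi_pos
  rw [Ne, Real.sin_eq_zero_iff_of_lt_of_lt (by linarith [hmem.1]) (by linarith [hmem.2])]
  intro h0
  rcases le_total r (3 / 4) with h | h
  · exact hne (hlam.strictMono.injOn ⟨hr.1, h⟩ ⟨by norm_num, by norm_num⟩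
      (h0.trans hlam.at_two_thirds.symm))
  · rw [hlam.eq_of_ge r ⟨h, hr.2⟩] at h0
    linarith

namespace IsFoliatedTube

variable {n : ℕ} {H : Type*} [TopologicalSpace H]
  {I : ModelWithCorners ℝ (EuclideanSpace ℝ (Fin (n + 1))) H}
  {M : Type*} [MetricSpace M] [ChartedSpace H M]
  {F : CodimOneFoliation I M} {γ : ℝ → M} {Φ : EuclideanSpace ℝ (Fin n) × ℝ → M}
  {lam : ℝ → ℝ} {θ : EuclideanSpace ℝ (Fin n)}

/-- The circle `{2/3 θ} × S¹` is tangent to the turbulized field, since `ω = dr` there. -/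
lemma joined_circle (hΦ : IsFoliatedTube F γ Φ) (hlam : IsTurbulizationProfile lam)
    (hθ : ‖θ‖ = 1) (t₀ t₁ : ℝ) :
    TangentiallyJoined I (turbulizedField F Φ lam) (Φ ((2 / 3 : ℝ) • θ, t₀))
      (Φ ((2 / 3 : ℝ) • θ, t₁)) := by
  have h := hΦ.joined_turbulizedField (lam := lam)
    (q := fun s : ℝ => ((2 / 3 : ℝ) • θ, t₀ + s * (t₁ - t₀))) (q' := fun _ => (0, t₁ - t₀))
    (by fun_prop)
    (fun s => by
      simpa using (hasDerivAt_const s ((2 / 3 : ℝ) • θ)).prodMk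
        (((hasDerivAt_id s).mul_const (t₁ - t₀)).const_add t₀))
    (fun s _ => by rw [mem_tubeDomain, norm_smul, hθ]; norm_num)
    (fun s _ => by
      have hn : ‖(2 / 3 : ℝ) • θ‖ = 2 / 3 := by rw [norm_smul, hθ]; norm_num
      simp only [turbulizationForm, hn, hlam.at_two_thirds, inner_zero_right, Real.sin_zero]
      simp)
  simpa using h

/-- The turbulized leaf through `(r θ, t₀)`, `r ≠ 2/3`, contains a point `(r' θ, t')` for every `r'`
between `r` and `2/3`: follow the solution of `dt/dr = - cot λ(r)`. -/
lemma exists_joined_spiral (hΦ : IsFoliatedTube F γ Φ) (hlam : IsTurbulizationProfile lam)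
    (hθ : ‖θ‖ = 1) {r : ℝ} (hr : r ∈ Ioo (0 : ℝ) 1) (hr' : r ≠ 2 / 3) (t₀ : ℝ) {η : ℝ}
    (hη : η ∈ Ioc (0 : ℝ) 1) :
    ∃ t₁ : ℝ, TangentiallyJoined I (turbulizedField F Φ lam) (Φ (r • θ, t₀))
      (Φ ((2 / 3 + η * (r - 2 / 3)) • θ, t₁)) := by
  -- The radius is an affine function of the parameter; `t` is then a primitive of `- cot λ · dr`.
  let R : ℝ → ℝ := fun s => 2 / 3 + (1 - s * (1 - η)) * (r - 2 / 3)
  have hκ : ∀ s ∈ Icc (0 : ℝ) 1, 0 < 1 - s * (1 - η) ∧ 1 - s * (1 - η) ≤ 1 := fun s hs => by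
    constructor
    · nlinarith [hs.1, hs.2, hη.1, hη.2]
    · nlinarith [hs.1, hs.2, hη.1, hη.2]
  have hR : ∀ s ∈ Icc (0 : ℝ) 1, R s ∈ Ioo (0 : ℝ) 1 := fun s hs => by
    obtain ⟨h0, h1⟩ := hκ s hs
    simp only [R]
    generalize 1 - s * (1 - η) = κ at h0 h1
    constructor <;> nlinarith [mul_pos h0 hr.1, mul_pos h0 (sub_pos.2 hr.2)]
  have hRne : ∀ s ∈ Icc (0 : ℝ) 1, R s ≠ 2 / 3 := fun s hs h => by
    have := mul_ne_zero (hκ s hs).1.ne' (sub_ne_zero.2 hr')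
    apply this
    simp only [R] at h
    linarith
  have hsin : ∀ s ∈ Icc (0 : ℝ) 1, Real.sin (lam (R s)) ≠ 0 := fun s hs =>
    hlam.sin_ne_zero (Ioo_subset_Icc_self (hR s hs)) (hRne s hs)
  have hRcont : Continuous R := by fun_prop
  have hlamR : ContinuousOn (fun s => lam (R s)) (Icc 0 1) :=
    hlam.smooth.continuousOn.comp hRcont.continuousOn fun s hs => Ioo_subset_Icc_self (hR s hs)
  let R' : ℝ := (η - 1) * (r - 2 / 3)
  have hRder : ∀ s, HasDerivAt R R' s := fun s => by
    have := ((((hasDerivAt_id s).mul_const (1 - η)).const_sub 1).mul_const (r - 2 / 3)).const_add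
      (2 / 3)
    simpa [R, R'] using this
  obtain ⟨T, T', hT, hT0, hTder, hT'⟩ := exists_primitive_Icc
    (f := fun s => -(Real.cos (lam (R s)) / Real.sin (lam (R s)) * R'))
    ((((Real.continuous_cos.comp_continuousOn hlamR).div
      (Real.continuous_sin.comp_continuousOn hlamR) hsin).mul continuousOn_const).neg) t₀
  have hnorm : ∀ s ∈ Icc (0 : ℝ) 1, ‖R s • θ‖ = R s := fun s hs => by
    rw [norm_smul, hθ, mul_one, Real.norm_of_nonneg (hR s hs).1.le]
  have h := hΦ.joined_turbulizedField (lam := lam)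
    (q := fun s : ℝ => (R s • θ, T s)) (q' := fun s => (R' • θ, T' s))
    (by fun_prop)
    (fun s => ((hRder s).smul_const θ).prodMk (hTder s))
    (fun s hs => by rw [mem_tubeDomain, hnorm s hs]; exact (hR s hs).2)
    (fun s hs => by
      have h1 := hsin s hs
      have h2 := (hR s hs).1.ne'
      simp only [turbulizationForm, hnorm s hs, hT' s hs, inner_smul_left, inner_smul_right,
        real_inner_self_eq_norm_sq, hθ, conj_trivial]
      field_simp
      ring)
  refine ⟨T 1, ?_⟩
  have e0 : R 0 = r := by simp [R]
  have e1 : R 1 = 2 / 3 + η * (r - 2 / 3) := by simp [R]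
  simpa only [e0, e1, hT0] using h

/-- The points `(r θ, t)` tend to `(2/3 θ, t)` uniformly in `t` when `r → 2/3`. -/
lemma eventually_dist_lt (hΦ : IsFoliatedTube F γ Φ) (hθ : ‖θ‖ = 1) {ε : ℝ} (hε : 0 < ε) :
    ∀ᶠ r in 𝓝 (2 / 3 : ℝ), ∀ t, dist (Φ (r • θ, t)) (Φ ((2 / 3 : ℝ) • θ, t)) < ε := by
  have hmaps : MapsTo (fun p : ℝ × ℝ => (p.1 • θ, p.2)) (Icc (1 / 2) (3 / 4) ×ˢ Icc 0 1)
      (tubeDomain n) := by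
    rintro ⟨r, t⟩ ⟨hr, -⟩
    rw [mem_tubeDomain, norm_smul, hθ, Real.norm_of_nonneg (by linarith [hr.1])]
    linarith [hr.2]
  have hcont : ContinuousOn (fun p : ℝ × ℝ => Φ (p.1 • θ, p.2))
      (Icc (1 / 2) (3 / 4) ×ˢ Icc 0 1) :=
    hΦ.contMDiffOn.continuousOn.comp (by fun_prop) hmaps
  have hunif := (isCompact_Icc.prod isCompact_Icc).uniformContinuousOn_of_continuous hcont
  obtain ⟨δ, hδ, h⟩ := Metric.uniformContinuousOn_iff.1 hunif ε hε
  filter_upwards [Metric.ball_mem_nhds _ hδ,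
    Icc_mem_nhds (show (1 / 2 : ℝ) < 2 / 3 by norm_num) (show (2 / 3 : ℝ) < 3 / 4 by norm_num)]
    with r hr hr' t
  have hlt : ∀ r ∈ Icc (1 / 2 : ℝ) (3 / 4), ‖r • θ‖ < 1 := fun r hr => by
    rw [norm_smul, hθ, Real.norm_of_nonneg (by linarith [hr.1])]
    linarith [hr.2]
  have h23 : (2 / 3 : ℝ) ∈ Icc (1 / 2 : ℝ) (3 / 4) := by constructor <;> norm_num
  have hfr : Int.fract t ∈ Icc (0 : ℝ) 1 := ⟨Int.fract_nonneg t, (Int.fract_lt_one t).le⟩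
  -- By periodicity it suffices to consider `t ∈ [0, 1]`, where uniform continuity applies.
  rw [← hΦ.map_fract (hlt r hr'), ← hΦ.map_fract (hlt _ h23)]
  refine h (r, Int.fract t) ⟨hr', hfr⟩ (2 / 3, Int.fract t) ⟨h23, hfr⟩ ?_
  simpa [Prod.dist_eq, hδ] using hr

/-- In the Hausdorff leaf space, every point `(r θ, t)` with `0 < r < 1` has the class of the circle
`{2/3 θ} × S¹`, which its turbulized leaf approaches. -/
lemma hlsProj_eq_circle (hΦ : IsFoliatedTube F γ Φ) (hlam : IsTurbulizationProfile lam)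
    (hθ : ‖θ‖ = 1) {r : ℝ} (hr : r ∈ Ioo (0 : ℝ) 1) (t t' : ℝ) :
    hlsProj I (turbulizedField F Φ lam) (Φ (r • θ, t)) =
      hlsProj I (turbulizedField F Φ lam) (Φ ((2 / 3 : ℝ) • θ, t')) := by
  by_cases hne : r = 2 / 3
  · rw [hne]
    exact hlsProj_eq_of_joined (hΦ.joined_circle hlam hθ t t')
  refine eq_of_forall_dist_le fun ε hε => ?_
  have htend : Filter.Tendsto (fun η : ℝ => 2 / 3 + η * (r - 2 / 3)) (𝓝[>] 0) (𝓝 (2 / 3)) := by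
    have : Continuous fun η : ℝ => 2 / 3 + η * (r - 2 / 3) := by fun_prop
    exact (this.tendsto' 0 (2 / 3) (by simp)).mono_left nhdsWithin_le_nhds
  obtain ⟨η, hη, hηmem⟩ := ((htend.eventually (hΦ.eventually_dist_lt hθ hε)).and
    (Ioc_mem_nhdsGT (zero_lt_one (α := ℝ)))).exists
  obtain ⟨t₁, ht₁⟩ := hΦ.exists_joined_spiral hlam hθ hr hne t hηmem
  rw [hlsProj_eq_of_joined ht₁, hlsProj_eq_of_joined (hΦ.joined_circle hlam hθ t' t₁)]
  refine ((lipschitzWith_hlsProj (turbulizedField F Φ lam)).dist_le_mul _ _).trans ?_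
  simpa using (hη t₁).le

/-- By continuity at `r = 0`, the class of the circle `{2/3 θ} × S¹` is that of every point of the
axis. -/
lemma hlsProj_eq_axis (hΦ : IsFoliatedTube F γ Φ) (hlam : IsTurbulizationProfile lam)
    (hθ : ‖θ‖ = 1) (t t' : ℝ) :
    hlsProj I (turbulizedField F Φ lam) (Φ (0, t)) =
      hlsProj I (turbulizedField F Φ lam) (Φ ((2 / 3 : ℝ) • θ, t')) := by
  have hcont : ContinuousAt
      (fun r : ℝ => hlsProj I (turbulizedField F Φ lam) (Φ (r • θ, t))) 0 := by
    have h0 : ((0 : ℝ) • θ, t) ∈ tubeDomain n := by simp [mem_tubeDomain]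
    have h1 : ContinuousAt Φ ((0 : ℝ) • θ, t) :=
      hΦ.contMDiffOn.continuousOn.continuousAt ((isOpen_tubeDomain n).mem_nhds h0)
    have h2 : ContinuousAt (fun r : ℝ => (r • θ, t)) 0 := by fun_prop
    exact (lipschitzWith_hlsProj _).continuous.continuousAt.comp
      (h1.comp (f := fun r : ℝ => (r • θ, t)) h2)
  have hlim := hcont.tendsto.mono_left (nhdsWithin_le_nhds (s := Ioi 0))
  rw [zero_smul] at hlim
  refine tendsto_nhds_unique hlim (tendsto_const_nhds.congr' ?_)
  filter_upwards [Ioo_mem_nhdsGT (zero_lt_one (α := ℝ))] with r hr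
  exact (hΦ.hlsProj_eq_circle hlam hθ hr t t').symm

/-- The whole tube becomes one point in the Hausdorff leaf space of the turbulized foliation. -/
lemma hlsProj_eq_of_mem_tube (hn : 1 ≤ n) (hΦ : IsFoliatedTube F γ Φ)
    (hlam : IsTurbulizationProfile lam) {x y : M} (hx : x ∈ Φ '' tubeDomain n)
    (hy : y ∈ Φ '' tubeDomain n) :
    hlsProj I (turbulizedField F Φ lam) x = hlsProj I (turbulizedField F Φ lam) y := by
  -- Unit vectors `θ` exist since `n ≠ 0`.
  have : Nonempty (Fin n) := ⟨⟨0, hn⟩⟩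
  obtain ⟨θ₀, hθ₀⟩ := exists_norm_eq (EuclideanSpace ℝ (Fin n)) zero_le_one
  have key : ∀ p ∈ tubeDomain n, hlsProj I (turbulizedField F Φ lam) (Φ p) =
      hlsProj I (turbulizedField F Φ lam) (Φ (0, 0)) := by
    rintro ⟨v, t⟩ hp
    rw [mem_tubeDomain] at hp
    rcases eq_or_ne v 0 with rfl | hv
    · rw [hΦ.hlsProj_eq_axis hlam hθ₀ t 0, hΦ.hlsProj_eq_axis hlam hθ₀ 0 0]
    · have hv' : ‖v‖ ≠ 0 := norm_ne_zero_iff.2 hv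
      have hθ : ‖‖v‖⁻¹ • v‖ = 1 := by rw [norm_smul, norm_inv, norm_norm, inv_mul_cancel₀ hv']
      have h := hΦ.hlsProj_eq_circle hlam hθ ⟨norm_pos_iff.2 hv, hp⟩ t 0
      rw [smul_inv_smul₀ hv'] at h
      rw [h, hΦ.hlsProj_eq_axis hlam hθ 0 0]
  obtain ⟨p, hp, rfl⟩ := hx
  obtain ⟨q, hq, rfl⟩ := hy
  rw [key p hp, key q hq]

/-- The whole tube is projected to `γ([0, 1])` in the original Hausdorff leaf space, since every disc
meets `γ`. -/
lemma hlsProj_mem_image_of_mem_tube (hΦ : IsFoliatedTube F γ Φ) {x : M}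
    (hx : x ∈ Φ '' tubeDomain n) :
    hlsProj I F.tangent x ∈ hlsProj I F.tangent '' (γ '' Icc 0 1) := by
  obtain ⟨p, hp, rfl⟩ := hx
  refine ⟨γ p.2, ⟨Int.fract p.2, ⟨Int.fract_nonneg _, (Int.fract_lt_one _).le⟩, ?_⟩,
    hlsProj_eq_of_joined (hΦ.joined_disc hp)⟩
  rw [← hΦ.core, ← hΦ.core, hΦ.map_fract (by simp)]

end IsFoliatedTube

/-! ### The isometry -/

theorem mainTheorem6 {n : ℕ} (hn : 1 ≤ n)
    {H : Type*} [TopologicalSpace H]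
    {I : ModelWithCorners ℝ (EuclideanSpace ℝ (Fin (n + 1))) H}
    {M : Type*} [MetricSpace M] [CompactSpace M] [ConnectedSpace M]
    [ChartedSpace H M] [IsManifold I ∞ M]
    [Bundle.RiemannianBundle (fun x : M => TangentSpace I x)]
    [IsContMDiffRiemannianBundle I ∞ (EuclideanSpace ℝ (Fin (n + 1)))
      (fun x : M => TangentSpace I x)]
    [IsRiemannianManifold I M]
    (F : CodimOneFoliation I M) (γ : ℝ → M) (hγ : IsClosedTransversal F γ)
    (Φ : EuclideanSpace ℝ (Fin n) × ℝ → M) (hΦ : IsFoliatedTube F γ Φ)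
    (lam : ℝ → ℝ) (hlam : IsTurbulizationProfile lam) :
    ∃ f : CollapsedSpace (hlsProj I F.tangent '' (γ '' Icc 0 1)) ≃ᵢ
        HausdorffLeafSpace I (turbulizedField F Φ lam),
      ∀ x : M, f (CollapsedSpace.proj _ (hlsProj I F.tangent x)) =
        hlsProj I (turbulizedField F Φ lam) x := by
  have hA : IsClosed (hlsProj I F.tangent '' (γ '' Icc 0 1)) :=
    ((isCompact_Icc.image hγ.smooth.continuous).image
      (lipschitzWith_hlsProj F.tangent).continuous).isClosed
  have hT := hΦ.isOpen_image
  have hK := hΦ.isClosed_tubeCore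
  have hKT : tubeCore Φ ⊆ Φ '' tubeDomain n := IsFoliatedTube.tubeCore_subset
  have hF : ∀ x y, TangentiallyJoined I F.tangent x y →
      hlsProj I (turbulizedField F Φ lam) x = hlsProj I (turbulizedField F Φ lam) y :=
    fun x y hxy => eq_of_tangentiallyJoined hT hK hKT
      (fun x hx y hy => hΦ.hlsProj_eq_of_mem_tube hn hlam hx hy)
      (fun w => hΦ.mem_turbulizedField_of_mem_tangent hlam) smul_mem_turbulizedField
      (fun x y => hlsProj_eq_of_joined) hxy
  have hγT : ∀ t, γ t ∈ Φ '' tubeDomain n := fun t =>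
    ⟨(0, t), by simp [mem_tubeDomain], hΦ.core t⟩
  refine exists_isometryEquiv_collapsed hA hF ?_ ?_
  · -- Both points have the class of a point of `γ` in `HLS(F)`, hence also in the turbulized space.
    obtain ⟨g, -, hg⟩ := exists_lift_hlsProj
      (lipschitzWith_hlsProj (turbulizedField F Φ lam)) hF
    rintro x y ⟨_, ⟨s, -, rfl⟩, hs⟩ ⟨_, ⟨t, -, rfl⟩, ht⟩
    rw [← hg x, ← hg y, ← hs, ← ht, hg, hg]
    exact hΦ.hlsProj_eq_of_mem_tube hn hlam (hγT s) (hγT t)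
  · intro x y hxy
    refine eq_of_tangentiallyJoined
      (g := fun x => CollapsedSpace.proj (hlsProj I F.tangent '' (γ '' Icc 0 1))
        (hlsProj I F.tangent x)) hT hK hKT (fun x hx y hy => ?_)
      (fun w => hΦ.mem_tangent_of_mem_turbulizedField hlam) F.smul_mem_tangent
      (fun x y h => congrArg _ (hlsProj_eq_of_joined h)) hxy
    exact (MetricQuotient.mk_eq_mk _).2
      (Or.inr ⟨hΦ.hlsProj_mem_image_of_mem_tube hx, hΦ.hlsProj_mem_image_of_mem_tube hy⟩)
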